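/- Let $d,w\ge 1$, $D=dw$, $Q\ge 0$ and $\alpha\in(0,1]$. For a reflection $R$ on $\mathbb C^d$ (a unitary with $R^2=I$) put $R^\alpha=\tfrac12(I+R)+e^{-\mathrm i\pi\alpha}\tfrac12(I-R)$. Let $\mathcal C$ be an oracle circuit on $\mathbb C^D=\mathbb C^d\otimes\mathbb C^w$, that is, a finite sequence of gates, each of which is either a fixed unitary on $\mathbb C^D$ or a query to the oracle $Z$ or $Z^\dagger$ acting on the factor $\mathbb C^d$, and suppose that it makes exactly $Q$ queries. Write $\mathcal C(Z)\in \mathrm U(D)$ for the unitary that it implements when the oracle is $Z\in\mathrm U(d)$. Then there is an oracle circuit $\mathcal C'$ on $(\mathbb C^2)^{\otimes Q}\otimes\mathbb C^D$ (with $Q$ ancilla qubits), which depends on $\mathcal C$ and $\alpha$ but not on $R$, and which consists of fixed unitaries and at most $50+100\alpha Q$ queries to controlled-$R$, $|0\rangle\langle 0|\otimes I+|1\rangle\langle 1|\otimes R$ (with one of the ancilla qubits as control and the factor $\mathbb C^d$ as target), such that the following holds for every reflection $R\in \mathrm U(d)$. Let $\mathcal C_R\in\mathrm U(2^QD)$ be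 the unitary that $\mathcal C'$ implements with this $R$. For every unit vector $|\psi\rangle\in\mathbb C^D$ there are a scalar $\nu\in\mathbb C$, a unit vector $|\widetilde{\mathrm{out}}\rangle\in\mathbb C^D$ and a vector $|\Phi^\perp\rangle$ with $(\langle 0|^{\otimes Q}\otimes I)|\Phi^\perp\rangle=0$ such that $$\mathcal C_R\,|0\rangle^{\otimes Q}|\psi\rangle=\nu\,|0\rangle^{\otimes Q}|\widetilde{\mathrm{out}}\rangle+|\Phi^\perp\rangle,$$ $$|\nu|\ge 0.99\exp\!\left(-\alpha\pi\tfrac Q2\right)\qquad\text{and}\qquad \left\||\widetilde{\mathrm{out}}\rangle-\mathcal C(R^\alpha)|\psi\rangle\right\|_2<\exp(-99\alpha\pi Q-20).$$ -/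

import Mathlib

open scoped Matrix Kronecker

noncomputable section

namespace QueryCircuit

/-- A gate of an oracle circuit on the Hilbert space with computational basis `n`: either a fixed
unitary on the whole space (independent of the oracle), or an oracle query with label `q`. -/
inductive Gate (n : Type*) [Fintype n] [DecidableEq n] (q : Type*)
  | unitary (U : Matrix.unitaryGroup n ℂ) : Gate n q
  | query (a : q) : Gate n q

/-- An oracle circuit: the list of its gates, in the order in which they are applied. -/
abbrev Circuit (n : Type*) [Fintype n] [DecidableEq n] (q : Type*) := List (Gate n q)

variable {n : Type*} [Fintype n] [DecidableEq n] {q : Type*}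

/-- The operator of a gate, given the operators answering the queries. -/
def Gate.eval (oracle : q → Matrix n n ℂ) : Gate n q → Matrix n n ℂ
  | .unitary U => (U : Matrix n n ℂ)
  | .query a => oracle a

/-- The operator implemented by a circuit: the first gate of the list acts first. -/
def Circuit.eval (oracle : q → Matrix n n ℂ) : Circuit n q → Matrix n n ℂ
  | [] => 1
  | g :: gs => Circuit.eval oracle gs * g.eval oracle

/-- The number of oracle queries made by a circuit. -/
def Circuit.queryCount : Circuit n q → ℕ
  | [] => 0
  | .unitary _ :: gs => Circuit.queryCount gs
  | .query _ :: gs => Circuit.queryCount gs + 1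

/-- The fractional power `R ^ α = (1 + R) / 2 + exp (-iπα) (1 - R) / 2` of a reflection `R`. -/
def fracPow {d : ℕ} (R : Matrix (Fin d) (Fin d) ℂ) (α : ℝ) : Matrix (Fin d) (Fin d) ℂ :=
  (1 / 2 : ℂ) • (1 + R) +
    (Complex.exp (-(Complex.I * (Real.pi : ℂ) * (α : ℂ))) * (1 / 2 : ℂ)) • (1 - R)

/-- The two queries to `Z`, acting on the `d`-dimensional register of `ℂ^d ⊗ ℂ^W`:
label `false` is `Z ⊗ I` and label `true` is `Z† ⊗ I`. -/
def fracOracle {d : ℕ} {W : Type*} [DecidableEq W] (Z : Matrix (Fin d) (Fin d) ℂ) :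
    Bool → Matrix (Fin d × W) (Fin d × W) ℂ
  | false => Z ⊗ₖ (1 : Matrix W W ℂ)
  | true => Zᴴ ⊗ₖ (1 : Matrix W W ℂ)

/-- The queries to controlled-`R` on `(ℂ²)^{⊗ Q} ⊗ (ℂ^d ⊗ ℂ^W)`: the label `i` is the ancilla qubit
used as the control, so the operator is `|0⟩⟨0|_i ⊗ I + |1⟩⟨1|_i ⊗ R`. -/
def ctrlOracle {d : ℕ} {W : Type*} [DecidableEq W] (Q : ℕ) (R : Matrix (Fin d) (Fin d) ℂ)
    (i : Fin Q) :
    Matrix ((Fin Q → Fin 2) × (Fin d × W)) ((Fin Q → Fin 2) × (Fin d × W)) ℂ :=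
  (Matrix.diagonal fun b : Fin Q → Fin 2 => if b i = 0 then (1 : ℂ) else 0) ⊗ₖ
      (1 : Matrix (Fin d × W) (Fin d × W) ℂ) +
    (Matrix.diagonal fun b : Fin Q → Fin 2 => if b i = 1 then (1 : ℂ) else 0) ⊗ₖ
      (R ⊗ₖ (1 : Matrix W W ℂ))

/-- A matrix acting on a vector of the Euclidean space `ℂ^n`. -/
def act (M : Matrix n n ℂ) (v : EuclideanSpace ℂ n) : EuclideanSpace ℂ n :=
  WithLp.toLp 2 (M *ᵥ v.ofLp)

/-- The vector `|0⟩^{⊗ Q} ⊗ v`. -/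
def zeroKet {m : Type*} (Q : ℕ) (v : EuclideanSpace ℂ m) :
    EuclideanSpace ℂ ((Fin Q → Fin 2) × m) :=
  WithLp.toLp 2 fun p => if p.1 = 0 then v p.2 else 0

/-- The vector `(⟨0|^{⊗ Q} ⊗ I) Φ`. -/
def zeroBra {m : Type*} (Q : ℕ) (Φ : EuclideanSpace ℂ ((Fin Q → Fin 2) × m)) :
    EuclideanSpace ℂ m :=
  WithLp.toLp 2 fun x => Φ (0, x)

end QueryCircuit

end

/-! A query to `R ^ α` or its inverse is `z₀ I + z₁ R` with `|z₀| ≤ 1` and `|z₁| ≤ πα/2`, so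
expanding every query turns the circuit into a weighted sum of words in `R` indexed by bit strings,
where the Hamming weight counts the genuine uses of `R`. A linear combination of unitaries on the
ancillas (prepare, select, unprepare) realises this sum as a block scaled by `1/N`. Here `N = ∏
(|z₀| + |z₁|) ≤ exp(παQ/2)`, which gives the bound on `ν`.

The weight distribution is concentrated near `O(αQ)`, so by a Chernoff bound words of weight above a
cutoff `k` of order `αQ` may be replaced by arbitrary unitaries (`sum_tail_le`,
`norm_act_sum_sub_le`). A word of weight at most `k` has the form `g_k S g_{k-1} ⋯ S g_0` with
unused slots trivial, so `k` shared queries serve all such words at once (`exists_slots`,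
`slotEval_truncate`).

Each slot needs a control qubit flagging whether the word is already exhausted, but only `Q`
ancillas are available. The first query is therefore handled separately on qubit 0, at the cost of
one query, and qubit 0 is then reused as the flag. The flag is uncomputed after each slot, so the
slot circuit is block diagonal, and the final projection onto `|0⟩` also selects `|0⟩` on that qubit
before the slots (`exists_compressed_circuit`). -/

noncomputable section

set_option linter.unusedSectionVars false

namespace QueryCircuit

/-! ### Block operators controlled by the ancillas -/

section Blocks

variable {B m : Type*} [Fintype B] [DecidableEq B] [Fintype m] [DecidableEq m]

/-- The block-diagonal operator `∑ b, |b⟩⟨b| ⊗ u b`. -/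
def ctrl (u : B → Matrix m m ℂ) : Matrix (B × m) (B × m) ℂ :=
  Matrix.of fun p p' => if p.1 = p'.1 then u p.1 p.2 p'.2 else 0

/-- The block `(⟨b| ⊗ I) M (|b'⟩ ⊗ I)`. -/
def blk (M : Matrix (B × m) (B × m) ℂ) (b b' : B) : Matrix m m ℂ :=
  M.submatrix (Prod.mk b) (Prod.mk b')

theorem blk_mul (M N : Matrix (B × m) (B × m) ℂ) (b b' : B) :
    blk (M * N) b b' = ∑ c, blk M b c * blk N c b' := by
  ext x y
  simp [blk, Matrix.mul_apply, Fintype.sum_prod_type, Matrix.sum_apply]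

theorem blk_ctrl (u : B → Matrix m m ℂ) (b b' : B) :
    blk (ctrl u) b b' = if b = b' then u b else 0 := by
  ext x y
  by_cases h : b = b' <;> simp [blk, ctrl, h]

theorem blk_kronecker_one (A : Matrix B B ℂ) (b b' : B) :
    blk (A ⊗ₖ (1 : Matrix m m ℂ)) b b' = A b b' • (1 : Matrix m m ℂ) := by
  ext x y
  simp [blk]

theorem ext_blk {M N : Matrix (B × m) (B × m) ℂ} (h : ∀ b b', blk M b b' = blk N b b') :
    M = N := by
  ext ⟨b, x⟩ ⟨b', y⟩
  exact congrFun (congrFun (h b b') x) y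

theorem ctrl_mul (u v : B → Matrix m m ℂ) : ctrl u * ctrl v = ctrl fun b => u b * v b := by
  refine ext_blk fun b b' => ?_
  simp only [blk_mul, blk_ctrl, ite_mul, zero_mul, Finset.sum_ite_eq, Finset.mem_univ, if_true]
  split_ifs with h
  · rw [h]
  · simp

theorem ctrl_one : ctrl (fun _ : B => (1 : Matrix m m ℂ)) = 1 := by
  refine ext_blk fun b b' => ?_
  ext x y
  by_cases h : b = b' <;> simp [blk, ctrl, h, Matrix.one_apply]

theorem ctrl_conjTranspose (u : B → Matrix m m ℂ) : (ctrl u)ᴴ = ctrl fun b => (u b)ᴴ := by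
  ext ⟨b, x⟩ ⟨b', y⟩
  by_cases h : b = b'
  · subst h; simp [ctrl]
  · simp [ctrl, h, Ne.symm h]

theorem ctrl_mem_unitaryGroup (u : B → Matrix.unitaryGroup m ℂ) :
    ctrl (fun b => (u b : Matrix m m ℂ)) ∈ Matrix.unitaryGroup (B × m) ℂ := by
  rw [Matrix.mem_unitaryGroup_iff, Matrix.star_eq_conjTranspose, ctrl_conjTranspose, ctrl_mul,
    ← ctrl_one]
  congr 1
  ext1 b
  exact Matrix.mem_unitaryGroup_iff.mp (u b).2

/-- The gate applying `u b` controlled on the basis state `b`. -/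
def ctrlGate {q : Type*} (u : B → Matrix.unitaryGroup m ℂ) : Gate (B × m) q :=
  .unitary ⟨_, ctrl_mem_unitaryGroup u⟩

/-- The gate applying `A` to the ancillas. -/
def ancGate {q : Type*} (A : Matrix.unitaryGroup B ℂ) : Gate (B × m) q :=
  .unitary ⟨(A : Matrix B B ℂ) ⊗ₖ (1 : Matrix m m ℂ),
    Matrix.kronecker_mem_unitary A.2 (one_mem _)⟩

theorem permMatrix_mem_unitaryGroup (σ : Equiv.Perm B) :
    σ.permMatrix ℂ ∈ Matrix.unitaryGroup B ℂ := by
  rw [Matrix.mem_unitaryGroup_iff, Matrix.star_eq_conjTranspose, Matrix.conjTranspose_permMatrix,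
    ← Matrix.permMatrix_mul]
  simp

/-- The unitary that permutes the basis states by `σ`. -/
def permUnitary (σ : Equiv.Perm B) : Matrix.unitaryGroup B ℂ :=
  ⟨_, permMatrix_mem_unitaryGroup σ⟩

/-- Computing a flag, using it as a control and uncomputing it creates no off-diagonal blocks; this
is what allows one flag qubit to serve every slot. -/
theorem perm_conj_ctrl (σ : Equiv.Perm B) (u : B → Matrix m m ℂ) :
    (σ.permMatrix ℂ ⊗ₖ (1 : Matrix m m ℂ)) * (ctrl u * (σ⁻¹.permMatrix ℂ ⊗ₖ (1 : Matrix m m ℂ)))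
      = ctrl fun b => u (σ b) := by
  refine ext_blk fun b b' => ?_
  simp only [blk_mul, blk_ctrl, blk_kronecker_one]
  rw [Finset.sum_eq_single (σ b) (fun c _ hc => ?_) (by simp), Finset.sum_eq_single (σ b)
    (fun c _ hc => by simp [hc.symm]) (by simp)]
  · by_cases h : b = b' <;> simp [Equiv.Perm.permMatrix, PEquiv.toMatrix_apply, h]
  · simp [Equiv.Perm.permMatrix, PEquiv.toMatrix_apply, hc.symm]

theorem blk_ctrl_mul (u : B → Matrix m m ℂ) (M : Matrix (B × m) (B × m) ℂ) (b b' : B) :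
    blk (ctrl u * M) b b' = u b * blk M b b' := by
  simp [blk_mul, blk_ctrl]

theorem blk_kronecker_one_mul (A : Matrix B B ℂ) (M : Matrix (B × m) (B × m) ℂ) (b b' : B) :
    blk ((A ⊗ₖ (1 : Matrix m m ℂ)) * M) b b' = ∑ c, A b c • blk M c b' := by
  simp [blk_mul, blk_kronecker_one]

theorem blk_sandwich (A₁ A₂ A₃ : Matrix B B ℂ) (u v : B → Matrix m m ℂ) (b b' : B) :
    blk ((A₃ ⊗ₖ (1 : Matrix m m ℂ)) * (ctrl u * ((A₂ ⊗ₖ (1 : Matrix m m ℂ)) *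
        (ctrl v * (A₁ ⊗ₖ (1 : Matrix m m ℂ)))))) b b'
      = ∑ c, ∑ c', (A₃ b c * A₂ c c' * A₁ c' b') • (u c * v c') := by
  simp only [blk_kronecker_one_mul, blk_ctrl_mul, blk_kronecker_one, Finset.mul_sum,
    Finset.smul_sum, mul_smul_comm, mul_one, smul_smul]
  refine Finset.sum_congr rfl fun c _ => Finset.sum_congr rfl fun c' _ => ?_
  rw [mul_assoc]

end Blocks

/-! ### Expansion of a circuit into words and their slot form -/

section CircuitLemmas

variable {n : Type*} [Fintype n] [DecidableEq n] {q : Type*}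

theorem Circuit.eval_append (o : q → Matrix n n ℂ) (C D : Circuit n q) :
    Circuit.eval o (C ++ D) = Circuit.eval o D * Circuit.eval o C := by
  induction C with
  | nil => simp [Circuit.eval]
  | cons g gs ih =>
    simp only [List.cons_append, Circuit.eval, ih, Matrix.mul_assoc]

theorem Circuit.queryCount_append (C D : Circuit n q) :
    Circuit.queryCount (C ++ D) = Circuit.queryCount C + Circuit.queryCount D := by
  induction C with
  | nil => simp [Circuit.queryCount]
  | cons g gs ih =>
    cases g
    · simp only [List.cons_append, Circuit.queryCount, ih]
    · simp only [List.cons_append, Circuit.queryCount, ih]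
      omega

/-- The operator of an alternating sequence of `P` queries, the `i`-th one with label `(L i).1` and
followed by the unitary `(L i).2`. -/
def altEval (o : q → Matrix n n ℂ) : (P : ℕ) → (Fin P → q × Matrix.unitaryGroup n ℂ) →
    Matrix n n ℂ
  | 0, _ => 1
  | P + 1, L => altEval o P (Fin.tail L) * ((L 0).2 * o (L 0).1)

theorem Circuit.exists_altEval (C : Circuit n q) :
    ∃ (U : Matrix.unitaryGroup n ℂ) (L : Fin C.queryCount → q × Matrix.unitaryGroup n ℂ),
      ∀ o : q → Matrix n n ℂ, C.eval o = altEval o C.queryCount L * U := by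
  induction C with
  | nil => exact ⟨1, fun i => i.elim0, fun o => by simp [Circuit.eval, altEval, Circuit.queryCount]⟩
  | cons g gs ih =>
    obtain ⟨U, L, h⟩ := ih
    cases g with
    | unitary V =>
      exact ⟨U * V, L, fun o => by
        simp [Circuit.eval, Gate.eval, h, Circuit.queryCount, Matrix.mul_assoc]⟩
    | query a =>
      refine ⟨1, Fin.cons (a, U) L, fun o => ?_⟩
      simp [Circuit.eval, Gate.eval, h, Circuit.queryCount, altEval, Matrix.mul_assoc]

/-- The operator of an alternating sequence where query `i` is answered by `S` if `b i = 1` and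
skipped otherwise. -/
def wordEval (S : Matrix n n ℂ) : (P : ℕ) → (Fin P → q × Matrix.unitaryGroup n ℂ) →
    (Fin P → Fin 2) → Matrix n n ℂ
  | 0, _, _ => 1
  | P + 1, L, b =>
    wordEval S P (Fin.tail L) (Fin.tail b) * ((L 0).2 * if b 0 = 0 then 1 else S)

/-- The Hamming weight of a bit string. -/
def hamming : (P : ℕ) → (Fin P → Fin 2) → ℕ
  | 0, _ => 0
  | P + 1, b => hamming P (Fin.tail b) + if b 0 = 0 then 0 else 1

theorem sum_bits_succ {M : Type*} [AddCommMonoid M] {P : ℕ} (f : (Fin (P + 1) → Fin 2) → M) :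
    ∑ b, f b = ∑ h : Fin 2, ∑ b : Fin P → Fin 2, f (Fin.cons h b) := by
  rw [← Fintype.sum_prod_type']
  exact (Fintype.sum_equiv (Fin.consEquiv fun _ => Fin 2) _ _ fun _ => rfl).symm

theorem altEval_eq_sum (o : q → Matrix n n ℂ) (S : Matrix n n ℂ) (z : q → Fin 2 → ℂ)
    (ho : ∀ a, o a = z a 0 • (1 : Matrix n n ℂ) + z a 1 • S) (P : ℕ)
    (L : Fin P → q × Matrix.unitaryGroup n ℂ) :
    altEval o P L = ∑ b, (∏ i, z (L i).1 (b i)) • wordEval S P L b := by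
  induction P with
  | zero => simp [altEval, wordEval]
  | succ P ih =>
    rw [sum_bits_succ]
    simp only [altEval, wordEval, Fin.prod_univ_succ, Fin.cons_zero, Fin.cons_succ, Fin.tail_cons,
      Fin.sum_univ_two, ih, ho]
    simp only [Fin.tail, mul_smul, Finset.sum_mul, ← Finset.sum_add_distrib]
    refine Finset.sum_congr rfl fun b _ => ?_
    simp [mul_add, smul_smul]

/-- The operator `g k * S (k-1) * g (k-1) * ⋯ * S 0 * g 0`. -/
def slotEval (S : ℕ → Matrix n n ℂ) (g : ℕ → Matrix n n ℂ) : ℕ → Matrix n n ℂ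
  | 0 => g 0
  | k + 1 => g (k + 1) * (S k * slotEval S g k)

/-- Between two genuine queries all fixed unitaries merge into one, and this merging is independent
of `S`. Making the slots beyond the weight trivial lets words of different weight share one circuit.
-/
theorem exists_slots (P : ℕ) (L : Fin P → q × Matrix.unitaryGroup n ℂ) (b : Fin P → Fin 2) :
    ∃ g : ℕ → Matrix.unitaryGroup n ℂ, (∀ j, hamming P b < j → g j = 1) ∧
      ∀ S : Matrix n n ℂ,
        slotEval (fun _ => S) (fun j => (g j : Matrix n n ℂ)) (hamming P b) = wordEval S P L b := by
  induction P with
  | zero => exact ⟨1, fun _ _ => rfl, fun S => rfl⟩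
  | succ P ih =>
    obtain ⟨g, hg, hS⟩ := ih (Fin.tail L) (Fin.tail b)
    by_cases h0 : b 0 = 0
    · refine ⟨fun j => if j = 0 then g 0 * (L 0).2 else g j, fun j hj => ?_, fun S => ?_⟩
      · simp only [hamming, h0, if_true, add_zero] at hj
        simp [(Nat.zero_le _).trans_lt hj |>.ne', hg j hj]
      · simp only [hamming, wordEval, h0, if_true, add_zero, ← hS, mul_one]
        generalize hamming P (Fin.tail b) = k
        induction k with
        | zero => simp [slotEval]
        | succ k ihk => simp [slotEval, ihk, Matrix.mul_assoc]
    -- The word now begins with a query: slot 0 is empty, the unitary following that query merges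
    -- into the old slot 0, and all old slots shift by one.
    · refine ⟨fun j => if j = 0 then 1 else if j = 1 then g 0 * (L 0).2 else g (j - 1),
        fun j hj => ?_, fun S => ?_⟩
      · simp only [hamming, h0, if_false] at hj
        have : j ≠ 0 ∧ j ≠ 1 := by omega
        simp [this.1, this.2, hg (j - 1) (by omega)]
      · simp only [hamming, wordEval, h0, if_false, ← hS]
        generalize hamming P (Fin.tail b) = k
        induction k with
        | zero => simp [slotEval, Matrix.mul_assoc]
        | succ k ihk =>
          rw [slotEval, ihk]
          simp [slotEval, Matrix.mul_assoc]

theorem slotEval_truncate (S : Matrix n n ℂ) (g : ℕ → Matrix n n ℂ) (w k : ℕ)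
    (hg : ∀ j, w < j → g j = 1) (hk : w ≤ k) :
    slotEval (fun j => if j < w then S else 1) g k = slotEval (fun _ => S) g w := by
  induction k, hk using Nat.le_induction with
  | base =>
    have : ∀ j ≤ w, slotEval (fun j => if j < w then S else 1) g j = slotEval (fun _ => S) g j := by
      intro j hj
      induction j with
      | zero => rfl
      | succ j ih => simp [slotEval, ih (by omega), show j < w by omega]
    exact this w le_rfl
  | succ k hk ih => simp [slotEval, ih, hg (k + 1) (by omega), show ¬ k < w by omega]

theorem slotEval_mem_unitaryGroup {S g : ℕ → Matrix n n ℂ}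
    (hS : ∀ j, S j ∈ Matrix.unitaryGroup n ℂ) (hg : ∀ j, g j ∈ Matrix.unitaryGroup n ℂ) (k : ℕ) :
    slotEval S g k ∈ Matrix.unitaryGroup n ℂ := by
  induction k with
  | zero => exact hg 0
  | succ k ih => exact mul_mem (hg _) (mul_mem (hS _) ih)

theorem wordEval_mem_unitaryGroup {S : Matrix n n ℂ} (hS : S ∈ Matrix.unitaryGroup n ℂ) (P : ℕ)
    (L : Fin P → q × Matrix.unitaryGroup n ℂ) (b : Fin P → Fin 2) :
    wordEval S P L b ∈ Matrix.unitaryGroup n ℂ := by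
  induction P with
  | zero => exact one_mem _
  | succ P ih =>
    refine mul_mem (ih _ _) (mul_mem (L 0).2.2 ?_)
    split_ifs
    exacts [one_mem _, hS]

theorem altEval_mem_unitaryGroup {o : q → Matrix n n ℂ} (ho : ∀ a, o a ∈ Matrix.unitaryGroup n ℂ)
    (P : ℕ) (L : Fin P → q × Matrix.unitaryGroup n ℂ) :
    altEval o P L ∈ Matrix.unitaryGroup n ℂ := by
  induction P with
  | zero => exact one_mem _
  | succ P ih => exact mul_mem (ih _) (mul_mem (L 0).2.2 (ho _))

end CircuitLemmas

/-! ### State preparation for linear combinations of unitaries -/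

section Columns

variable {B : Type*} [Fintype B] [DecidableEq B]

theorem exists_unitary_col (v : B → ℂ) (hv : ∑ b, ‖v b‖ ^ 2 = 1) (b₀ : B) :
    ∃ A : Matrix.unitaryGroup B ℂ, ∀ b, (A : Matrix B B ℂ) b b₀ = v b := by
  let f : B → EuclideanSpace ℂ B := fun _ => WithLp.toLp 2 v
  have hf : Orthonormal ℂ (({b₀} : Set B).domRestrict f) := by
    rw [orthonormal_iff_ite]
    rintro ⟨i, rfl⟩ ⟨j, rfl⟩
    have : ‖(WithLp.toLp 2 v : EuclideanSpace ℂ B)‖ = 1 := by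
      rw [EuclideanSpace.norm_eq]; simp [hv]
    simp [f, Set.domRestrict, inner_self_eq_norm_sq_to_K, this]
  obtain ⟨e, he⟩ := hf.exists_orthonormalBasis_extension_of_card_eq (by simp)
  refine ⟨⟨(EuclideanSpace.basisFun B ℂ).toBasis.toMatrix e,
    (EuclideanSpace.basisFun B ℂ).toMatrix_orthonormalBasis_mem_unitary e⟩, fun b => ?_⟩
  simp [Module.Basis.toMatrix_apply, he b₀ rfl, f]

theorem exists_unitary_row (v : B → ℂ) (hv : ∑ b, ‖v b‖ ^ 2 = 1) (b₀ : B) :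
    ∃ A : Matrix.unitaryGroup B ℂ, ∀ b, (A : Matrix B B ℂ) b₀ b = v b := by
  obtain ⟨A, hA⟩ := exists_unitary_col (fun b => star (v b)) (by simpa using hv) b₀
  refine ⟨star A, fun b => ?_⟩
  simp [Matrix.star_apply, hA]

/-- A pair of unitaries whose first column and first row have the entrywise product `w / ∑ ‖w‖`. -/
theorem exists_unitary_col_row (w : B → ℂ) (b₀ : B) (hw : 0 < ∑ b, ‖w b‖) :
    ∃ A A' : Matrix.unitaryGroup B ℂ, ∀ b,
      (A' : Matrix B B ℂ) b₀ b * (A : Matrix B B ℂ) b b₀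
        = ((∑ b, ‖w b‖ : ℝ) : ℂ)⁻¹ * w b := by
  set N := ∑ b, ‖w b‖ with hN
  have hsum : ∑ b, ‖w b‖ / N = 1 := by rw [← Finset.sum_div, ← hN, div_self hw.ne']
  have hnn : ∀ b, 0 ≤ ‖w b‖ / N := fun b => by positivity
  have hsq : ∀ b, ‖((√(‖w b‖ / N) : ℝ) : ℂ)‖ ^ 2 = ‖w b‖ / N := fun b => by
    rw [Complex.norm_real, Real.norm_eq_abs, sq_abs, Real.sq_sqrt (hnn b)]
  obtain ⟨A, hA⟩ := exists_unitary_col (fun b => ((√(‖w b‖ / N) : ℝ) : ℂ)) (by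
    simpa only [hsq] using hsum) b₀
  obtain ⟨A', hA'⟩ := exists_unitary_row
    -- The phases go entirely into the row. The value 1 at `w b = 0` only keeps the phase
    -- unimodular; the square root vanishes there.
    (fun b => (if w b = 0 then 1 else w b / ‖w b‖) * ((√(‖w b‖ / N) : ℝ) : ℂ)) (by
    rw [← hsum]
    refine Finset.sum_congr rfl fun b _ => ?_
    have : ‖(if w b = 0 then 1 else w b / ‖w b‖ : ℂ)‖ = 1 := by
      by_cases h : w b = 0 <;> simp [h]
    rw [norm_mul, this, one_mul, hsq]) b₀
  refine ⟨A, A', fun b => ?_⟩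
  rw [hA, hA', mul_assoc, ← Complex.ofReal_mul, Real.mul_self_sqrt (hnn b)]
  by_cases h : w b = 0
  · simp [h]
  · have : (‖w b‖ : ℂ) ≠ 0 := by simpa using h
    simp only [h, if_false, Complex.ofReal_div]
    field_simp

end Columns

/-! ### Compression of the queries, with qubit 0 reused as a flag -/

section Compression

variable {P : ℕ}

/-- The unitary `G ⊗ V` on `P + 1` qubits, where `G` acts on the qubit `0`. -/
def headTail (G : Matrix.unitaryGroup (Fin 2) ℂ) (V : Matrix.unitaryGroup (Fin P → Fin 2) ℂ) :
    Matrix.unitaryGroup (Fin (P + 1) → Fin 2) ℂ :=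
  ⟨((G : Matrix _ _ ℂ) ⊗ₖ (V : Matrix _ _ ℂ)).submatrix (Fin.consEquiv fun _ => Fin 2).symm
      (Fin.consEquiv fun _ => Fin 2).symm, by
    have h := Matrix.mem_unitaryGroup_iff.mp (Matrix.kronecker_mem_unitary G.2 V.2)
    rw [Matrix.mem_unitaryGroup_iff, Matrix.star_eq_conjTranspose, Matrix.conjTranspose_submatrix,
      Matrix.submatrix_mul_equiv, ← Matrix.star_eq_conjTranspose, h, Matrix.submatrix_one_equiv]⟩

theorem headTail_apply (G : Matrix.unitaryGroup (Fin 2) ℂ)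
    (V : Matrix.unitaryGroup (Fin P → Fin 2) ℂ) (β β' : Fin (P + 1) → Fin 2) :
    (headTail G V : Matrix _ _ ℂ) β β'
      = (G : Matrix _ _ ℂ) (β 0) (β' 0) * (V : Matrix _ _ ℂ) (Fin.tail β) (Fin.tail β') := rfl

/-- The last gate leaves qubit 0 alone, which forces it to be 0 in `c`; the first gate leaves the
other qubits alone, which forces them to be 0 in `c'`. Hence the combination for the first query and
the one for the remaining queries decouple. -/
theorem sum_headTail {m : Type*} [Fintype m] (G G' : Matrix.unitaryGroup (Fin 2) ℂ)
    (V V' : Matrix.unitaryGroup (Fin P → Fin 2) ℂ)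
    (u v : (Fin (P + 1) → Fin 2) → Matrix m m ℂ) :
    ∑ c, ∑ c', ((headTail 1 V').1 0 c * (headTail G' V).1 c c' * (headTail G 1).1 c' 0) • (u c * v c')
      = (∑ b, (V'.1 0 b * V.1 b 0) • u (Fin.cons 0 b)) *
        ∑ h, (G'.1 0 h * G.1 h 0) • v (Fin.cons h 0) := by
  have h0 : Fin.tail (0 : Fin (P + 1) → Fin 2) = 0 := rfl
  rw [sum_bits_succ, Fin.sum_univ_two, Finset.sum_mul]
  simp only [headTail_apply, Pi.zero_apply, Fin.cons_zero, Fin.tail_cons, h0, OneMemClass.coe_one,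
    Matrix.one_apply, if_true, zero_ne_one, if_false, zero_mul, zero_smul, Finset.sum_const_zero,
    add_zero, one_mul]
  refine Finset.sum_congr rfl fun b _ => ?_
  rw [sum_bits_succ, Finset.mul_sum]
  refine Finset.sum_congr rfl fun h _ => ?_
  rw [Finset.sum_eq_single 0 (fun c _ hc => by simp [hc]) (by simp)]
  simp only [Fin.cons_zero, Fin.tail_cons, if_true, mul_one, smul_mul_smul_comm]
  congr 1
  ring

/-- Flips the qubit `0` if the Hamming weight of the other qubits exceeds `j`. -/
def thresholdFlip (P j : ℕ) : Equiv.Perm (Fin (P + 1) → Fin 2) :=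
  Function.Involutive.toPerm
    (fun β => if j < hamming P (Fin.tail β) then Fin.cons (β 0 + 1) (Fin.tail β) else β) (by
      intro β
      by_cases h : j < hamming P (Fin.tail β)
      · simp only [h, if_true, Fin.tail_cons, Fin.cons_zero]
        rw [add_assoc, show (1 + 1 : Fin 2) = 0 from rfl, add_zero, Fin.cons_self_tail]
      · simp [h])

theorem thresholdFlip_cons_zero (j : ℕ) (b : Fin P → Fin 2) :
    (thresholdFlip P j (Fin.cons 0 b) : Fin (P + 1) → Fin 2) 0 = if j < hamming P b then 1 else 0 := by
  by_cases h : j < hamming P b <;> simp [thresholdFlip, Function.Involutive.toPerm, h]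

variable {d : ℕ} {W : Type*} [Fintype W] [DecidableEq W]

theorem ctrlOracle_eq_ctrl (Q : ℕ) (R : Matrix (Fin d) (Fin d) ℂ) (i : Fin Q) :
    ctrlOracle Q R i
      = ctrl fun b => if b i = 0 then 1 else (R ⊗ₖ (1 : Matrix W W ℂ)) := by
  ext ⟨b, x⟩ ⟨b', y⟩
  by_cases h : b = b'
  · subst h
    rcases Fin.exists_fin_two.mp ⟨b i, rfl⟩ with h0 | h1
    · simp [ctrlOracle, ctrl, h0]
    · simp [ctrlOracle, ctrl, h1]
  · simp [ctrlOracle, ctrl, h]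

/-- The circuit with `k` queries that applies `g j b` for `j = 0, …, k`, where `b` is the state of
the qubits other than the qubit `0`, with a query before `g (j + 1) b` if and only if the Hamming
weight of `b` exceeds `j`. The qubit `0` is meant to be in the state `|0⟩`. -/
def slotCircuit (g : ℕ → (Fin P → Fin 2) → Matrix.unitaryGroup (Fin d × W) ℂ) :
    ℕ → Circuit ((Fin (P + 1) → Fin 2) × (Fin d × W)) (Fin (P + 1))
  | 0 => [ctrlGate fun β => g 0 (Fin.tail β)]
  | k + 1 => slotCircuit g k ++
      [ancGate (permUnitary (thresholdFlip P k)⁻¹), .query 0,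
        ancGate (permUnitary (thresholdFlip P k)), ctrlGate fun β => g (k + 1) (Fin.tail β)]

theorem queryCount_slotCircuit (g : ℕ → (Fin P → Fin 2) → Matrix.unitaryGroup (Fin d × W) ℂ)
    (k : ℕ) : (slotCircuit g k).queryCount = k := by
  induction k with
  | zero => simp [slotCircuit, ctrlGate, Circuit.queryCount]
  | succ k ih =>
    simp [slotCircuit, Circuit.queryCount_append, ih, ctrlGate, ancGate, Circuit.queryCount]

theorem eval_slotCircuit (g : ℕ → (Fin P → Fin 2) → Matrix.unitaryGroup (Fin d × W) ℂ)
    (R : Matrix (Fin d) (Fin d) ℂ) (k : ℕ) :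
    (slotCircuit g k).eval (ctrlOracle (P + 1) R) = ctrl fun β =>
      slotEval (fun j => if thresholdFlip P j β 0 = 0 then 1 else (R ⊗ₖ (1 : Matrix W W ℂ)))
        (fun j => (g j (Fin.tail β) : Matrix _ _ ℂ)) k := by
  induction k with
  | zero => simp [slotCircuit, ctrlGate, Circuit.eval, Gate.eval, slotEval]
  | succ k ih =>
    simp only [slotCircuit, Circuit.eval_append, ih]
    simp only [Circuit.eval, Gate.eval, ancGate, ctrlGate, permUnitary, ctrlOracle_eq_ctrl, one_mul,
      slotEval]
    rw [Matrix.mul_assoc (ctrl _), Matrix.mul_assoc (ctrl _),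
      Matrix.mul_assoc (_ ⊗ₖ _), perm_conj_ctrl, ctrl_mul, ctrl_mul]
    simp only [Matrix.mul_assoc]

/-- Compression of `P + 1` queries into `k + 1` queries, exact on the words of weight at most `k`
in the last `P` queries. -/
theorem exists_compressed_circuit (U : Matrix.unitaryGroup (Fin d × W) ℂ)
    (L : Fin (P + 1) → Bool × Matrix.unitaryGroup (Fin d × W) ℂ) (z : Bool → Fin 2 → ℂ)
    (hz : ∀ a, 0 < ∑ h, ‖z a h‖) (k : ℕ) :
    ∃ C' : Circuit ((Fin (P + 1) → Fin 2) × (Fin d × W)) (Fin (P + 1)),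
      C'.queryCount = k + 1 ∧
      ∀ R ∈ Matrix.unitaryGroup (Fin d) ℂ,
        ∃ T : (Fin P → Fin 2) → Matrix (Fin d × W) (Fin d × W) ℂ,
          (∀ b, T b ∈ Matrix.unitaryGroup (Fin d × W) ℂ) ∧
          (∀ b, hamming P b ≤ k → T b = wordEval (R ⊗ₖ (1 : Matrix W W ℂ)) P (Fin.tail L) b) ∧
          blk (C'.eval (ctrlOracle (P + 1) R)) 0 0
            = ((∏ i, ∑ h, ‖z (L i).1 h‖ : ℝ) : ℂ)⁻¹ •
              ((∑ b, (∏ i, z (Fin.tail L i).1 (b i)) • T b) *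
                ((L 0).2 * (z (L 0).1 0 • 1 + z (L 0).1 1 • (R ⊗ₖ (1 : Matrix W W ℂ)))) * U) := by
  have hsum : ∑ b : Fin P → Fin 2, ‖∏ i, z (Fin.tail L i).1 (b i)‖
      = ∏ i, ∑ h, ‖z (Fin.tail L i).1 h‖ := by
    simp only [norm_prod, Finset.prod_univ_sum, Fintype.piFinset_univ]
  obtain ⟨G, G', hG⟩ := exists_unitary_col_row (z (L 0).1) 0 (hz _)
  obtain ⟨V, V', hV⟩ := exists_unitary_col_row
    (fun b : Fin P → Fin 2 => ∏ i, z (Fin.tail L i).1 (b i)) 0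
    (by rw [hsum]; exact Finset.prod_pos fun i _ => hz _)
  choose g hg1 hg using fun b => exists_slots P (Fin.tail L) b
  -- The middle gate `headTail G' V` unprepares qubit 0 and prepares the other qubits together.
  -- Words of weight above `k` simply lose their queries after the `k`-th, so `T b` is still
  -- unitary.
  refine ⟨[ancGate (headTail G 1), ctrlGate fun _ => U, .query 0, ctrlGate fun _ => (L 0).2,
      ancGate (headTail G' V)] ++ slotCircuit (fun j b => g b j) k ++ [ancGate (headTail 1 V')],
    ?_, fun R hR => ⟨fun b => slotEval
      (fun j => if j < hamming P b then (R ⊗ₖ (1 : Matrix W W ℂ)) else 1)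
      (fun j => (g b j : Matrix _ _ ℂ)) k, fun b => ?_, fun b hb => ?_, ?_⟩⟩
  · simp [Circuit.queryCount_append, queryCount_slotCircuit, ctrlGate, ancGate, Circuit.queryCount]
  · refine slotEval_mem_unitaryGroup (fun j => ?_) (fun j => (g b j).2) k
    split_ifs
    exacts [Matrix.kronecker_mem_unitary hR (one_mem _), one_mem _]
  · exact (slotEval_truncate _ _ _ _ (fun j hj => by rw [hg1 b j hj]; rfl) hb).trans (hg b _)
  · simp only [Circuit.eval_append, eval_slotCircuit]
    simp only [Circuit.eval, Gate.eval, ancGate, ctrlGate, ctrlOracle_eq_ctrl, one_mul,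
      Matrix.mul_assoc]
    rw [← Matrix.mul_assoc (ctrl _) (ctrl _), ctrl_mul, ← Matrix.mul_assoc (ctrl _) (ctrl _),
      ctrl_mul, blk_sandwich]
    rw [sum_headTail]
    simp only [hG, hV, hsum, thresholdFlip_cons_zero, Fin.tail_cons, Fin.cons_zero,
      Fin.prod_univ_succ, mul_smul,
      ← Finset.smul_sum]
    have hflip : ∀ (b : Fin P → Fin 2) (j : ℕ),
        (if (if j < hamming P b then (1 : Fin 2) else 0) = 0 then 1 else R ⊗ₖ (1 : Matrix W W ℂ))
          = if j < hamming P b then R ⊗ₖ (1 : Matrix W W ℂ) else 1 := fun b j => by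
      by_cases h : j < hamming P b <;> simp [h]
    simp only [hflip]
    rw [smul_mul_smul_comm, Complex.ofReal_mul, mul_inv, mul_comm (Complex.ofReal _)⁻¹]
    congr 2
    simp [Fin.sum_univ_two, add_mul, mul_add, Matrix.mul_assoc]

end Compression

/-! ### Postselection and unitarity of the fractional power -/

section Action

variable {n : Type*} [Fintype n] [DecidableEq n]

theorem act_mul (M N : Matrix n n ℂ) (v : EuclideanSpace ℂ n) :
    act (M * N) v = act M (act N v) := by
  simp [act, Matrix.mulVec_mulVec]

theorem act_smul (c : ℂ) (M : Matrix n n ℂ) (v : EuclideanSpace ℂ n) :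
    act (c • M) v = c • act M v := by
  simp [act, Matrix.smul_mulVec]

theorem act_sub (M N : Matrix n n ℂ) (v : EuclideanSpace ℂ n) :
    act (M - N) v = act M v - act N v := by
  simp [act, Matrix.sub_mulVec]

theorem act_sum {ι : Type*} (s : Finset ι) (M : ι → Matrix n n ℂ) (v : EuclideanSpace ℂ n) :
    act (∑ i ∈ s, M i) v = ∑ i ∈ s, act (M i) v := by
  simp [act, Matrix.sum_mulVec, WithLp.toLp_sum]

theorem norm_act_of_mem_unitaryGroup {M : Matrix n n ℂ} (hM : M ∈ Matrix.unitaryGroup n ℂ)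
    (v : EuclideanSpace ℂ n) : ‖act M v‖ = ‖v‖ := by
  have h : inner ℂ (act M v) (act M v) = inner ℂ v v := by
    simp only [EuclideanSpace.inner_eq_star_dotProduct, act]
    rw [dotProduct_comm, Matrix.star_mulVec, ← Matrix.dotProduct_mulVec, Matrix.mulVec_mulVec,
      ← Matrix.star_eq_conjTranspose, Matrix.mem_unitaryGroup_iff'.mp hM, Matrix.one_mulVec,
      dotProduct_comm]
  rw [inner_self_eq_norm_sq_to_K, inner_self_eq_norm_sq_to_K] at h
  have h' : ‖act M v‖ ^ 2 = ‖v‖ ^ 2 := by exact_mod_cast h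
  exact (sq_eq_sq₀ (norm_nonneg _) (norm_nonneg _)).mp h'

theorem zeroBra_act_zeroKet (Q : ℕ)
    (M : Matrix ((Fin Q → Fin 2) × n) ((Fin Q → Fin 2) × n) ℂ) (ψ : EuclideanSpace ℂ n) :
    zeroBra Q (act M (zeroKet Q ψ)) = act (blk M 0 0) ψ := by
  ext x
  simp [zeroBra, act, zeroKet, blk, Matrix.mulVec, dotProduct, Fintype.sum_prod_type,
    Finset.sum_ite_irrel]

/-- Splitting off the component on `|0⟩^{⊗ Q}` when it is close to a multiple of a unit vector. -/
theorem exists_postselected {Q : ℕ} (Ψ : EuclideanSpace ℂ ((Fin Q → Fin 2) × n))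
    (u e : EuclideanSpace ℂ n) (N δ : ℝ) (hN : 0 < N) (hu : ‖u‖ = 1) (he : ‖e‖ ≤ δ)
    (hδ : δ ≤ 1 / 100) (hΨ : zeroBra Q Ψ = (N : ℂ)⁻¹ • (u + e)) :
    ∃ (ν : ℂ) (out : EuclideanSpace ℂ n) (Φ : EuclideanSpace ℂ ((Fin Q → Fin 2) × n)),
      Ψ = ν • zeroKet Q out + Φ ∧ ‖out‖ = 1 ∧ zeroBra Q Φ = 0 ∧ 0.99 * N⁻¹ ≤ ‖ν‖ ∧
        ‖out - u‖ ≤ 2 * δ := by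
  set t := ‖u + e‖ with ht
  have hlow : 1 - δ ≤ t := by
    have := norm_sub_le (u + e) e
    rw [add_sub_cancel_right, hu] at this
    linarith
  have hupp : t ≤ 1 + δ := (norm_add_le u e).trans (by linarith)
  have ht0 : 0 < t := by linarith
  have htc : (t : ℂ) ≠ 0 := by exact_mod_cast ht0.ne'
  refine ⟨(N : ℂ)⁻¹ * t, (t : ℂ)⁻¹ • (u + e),
    Ψ - ((N : ℂ)⁻¹ * t) • zeroKet Q ((t : ℂ)⁻¹ • (u + e)), by abel, ?_, ?_, ?_, ?_⟩
  · rw [norm_smul, norm_inv, Complex.norm_real, Real.norm_eq_abs, abs_of_pos ht0, ← ht,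
      inv_mul_cancel₀ ht0.ne']
  · ext x
    have hx : Ψ (0, x) = (N : ℂ)⁻¹ * u x + (N : ℂ)⁻¹ * e x := by
      simpa [zeroBra] using congrArg (fun v : EuclideanSpace ℂ n => v x) hΨ
    simp [zeroBra, zeroKet, hx]
    field_simp
    ring
  · rw [norm_mul, norm_inv, Complex.norm_real, Complex.norm_real, Real.norm_eq_abs,
      Real.norm_eq_abs, abs_of_pos ht0, abs_of_pos hN, mul_comm]
    gcongr
    linarith
  -- The error `2 * δ` is one `δ` from renormalising and one from `e` itself.
  · have h1 : (t : ℂ)⁻¹ • (u + e) - u = ((t : ℂ)⁻¹ - 1) • (u + e) + e := by module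
    have h2 : ‖((t : ℂ)⁻¹ - 1) • (u + e)‖ = |1 - t| := by
      rw [norm_smul, ← ht, ← Complex.ofReal_inv, ← Complex.ofReal_one, ← Complex.ofReal_sub,
        Complex.norm_real, Real.norm_eq_abs]
      nth_rewrite 2 [← abs_of_pos ht0]
      rw [← abs_mul, sub_mul, inv_mul_cancel₀ ht0.ne', one_mul]
    rw [h1]
    refine (norm_add_le _ _).trans ?_
    rw [h2]
    have : |1 - t| ≤ δ := abs_le.mpr ⟨by linarith, by linarith⟩
    linarith

/-- The operator has eigenvalues 1 and `e` on the two eigenspaces of the reflection `S`. -/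
theorem smul_one_add_smul_mem_unitaryGroup {S : Matrix n n ℂ} (hS : Sᴴ = S) (hSS : S * S = 1)
    {e : ℂ} (he : ‖e‖ = 1) :
    ((1 + e) / 2) • (1 : Matrix n n ℂ) + ((1 - e) / 2) • S ∈ Matrix.unitaryGroup n ℂ := by
  have hee : e * star e = 1 := by
    have := Complex.mul_conj e
    rw [Complex.normSq_eq_norm_sq, he] at this
    simpa using this
  rw [Matrix.mem_unitaryGroup_iff, Matrix.star_eq_conjTranspose, Matrix.conjTranspose_add,
    Matrix.conjTranspose_smul, Matrix.conjTranspose_smul, hS, Matrix.conjTranspose_one]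
  simp only [add_mul, mul_add, smul_mul_smul_comm, hSS, mul_one, one_mul]
  have h1 : (1 + e) / 2 * star ((1 + e) / 2) + (1 - e) / 2 * star ((1 - e) / 2) = 1 := by
    simp only [star_div₀, star_add, star_sub, star_one, star_ofNat]
    linear_combination (1 / 2) * hee
  have h2 : (1 + e) / 2 * star ((1 - e) / 2) + (1 - e) / 2 * star ((1 + e) / 2) = 0 := by
    simp only [star_div₀, star_add, star_sub, star_one, star_ofNat]
    linear_combination (-1 / 2) * hee
  calc _ = ((1 + e) / 2 * star ((1 + e) / 2) + (1 - e) / 2 * star ((1 - e) / 2)) • (1 : Matrix n n ℂ)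
        + ((1 + e) / 2 * star ((1 - e) / 2) + (1 - e) / 2 * star ((1 + e) / 2)) • S := by module
    _ = 1 := by rw [h1, h2]; simp

end Action

/-! ### Chernoff bound for the word weights -/

section Tail

theorem pow_hamming (t : ℝ) (P : ℕ) (b : Fin P → Fin 2) :
    t ^ hamming P b = ∏ i, if b i = 0 then 1 else t := by
  induction P with
  | zero => simp [hamming]
  | succ P ih =>
    rw [Fin.prod_univ_succ, hamming, pow_add, ih, mul_comm]
    congr 1
    split_ifs <;> simp

/-- Each factor is at most `1 + y ≤ exp y`. This bounds both the normalisation `N` and the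
exponential moment in the Chernoff bound. -/
theorem prod_sum_le_exp {P : ℕ} (f : Fin P → Fin 2 → ℝ) (y : ℝ) (h0 : ∀ i h, 0 ≤ f i h)
    (hf0 : ∀ i, f i 0 ≤ 1) (hf1 : ∀ i, f i 1 ≤ y) :
    ∏ i, ∑ h, f i h ≤ Real.exp (P * y) := by
  calc ∏ i, ∑ h, f i h ≤ ∏ _i : Fin P, Real.exp y := by
        refine Finset.prod_le_prod (fun i _ => Finset.sum_nonneg fun h _ => h0 i h) fun i _ => ?_
        rw [Fin.sum_univ_two]
        have := Real.add_one_le_exp y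
        linarith [hf0 i, hf1 i]
    _ = Real.exp (P * y) := by simp [Real.exp_nat_mul]

/-- Chernoff bound for the total weight of the words of Hamming weight exceeding `k`. -/
theorem sum_tail_le {P : ℕ} (f : Fin P → Fin 2 → ℝ) (y : ℝ) (h0 : ∀ i h, 0 ≤ f i h)
    (hf0 : ∀ i, f i 0 ≤ 1) (hf1 : ∀ i, f i 1 ≤ y) (k : ℕ) (τ : ℝ) (hτ : 0 ≤ τ) :
    ∑ b : Fin P → Fin 2 with k < hamming P b, ∏ i, f i (b i)
      ≤ Real.exp (P * (Real.exp τ * y) - τ * (k + 1)) := by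
  have hprod : ∀ b : Fin P → Fin 2, 0 ≤ ∏ i, f i (b i) := fun b =>
    Finset.prod_nonneg fun i _ => h0 _ _
  have ht : 1 ≤ Real.exp τ := Real.one_le_exp hτ
  calc ∑ b : Fin P → Fin 2 with k < hamming P b, ∏ i, f i (b i)
      ≤ ∑ b : Fin P → Fin 2 with k < hamming P b,
          Real.exp (-(τ * (k + 1))) * (Real.exp τ ^ hamming P b * ∏ i, f i (b i)) := by
        refine Finset.sum_le_sum fun b hb => ?_
        rw [← mul_assoc]
        -- The inserted factor `exp(τ(hamming P b - (k + 1)))` is at least 1 on the tail; the full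
        -- weighted sum then factors over the positions.
        refine le_mul_of_one_le_left (hprod b) ?_
        have hk : k + 1 ≤ hamming P b := by simpa using hb
        calc (1 : ℝ) = Real.exp (-(τ * (k + 1))) * Real.exp τ ^ (k + 1) := by
              rw [← Real.exp_nat_mul, ← Real.exp_add, eq_comm, Real.exp_eq_one_iff]
              push_cast
              ring
          _ ≤ _ := by gcongr
    _ ≤ ∑ b : Fin P → Fin 2,
          Real.exp (-(τ * (k + 1))) * (Real.exp τ ^ hamming P b * ∏ i, f i (b i)) :=
        Finset.sum_le_sum_of_subset_of_nonneg (Finset.filter_subset _ _) fun b _ _ =>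
          mul_nonneg (Real.exp_pos _).le (mul_nonneg (by positivity) (hprod b))
    _ = Real.exp (-(τ * (k + 1))) *
          ∏ i, ∑ h : Fin 2, (if h = 0 then 1 else Real.exp τ) * f i h := by
        rw [← Finset.mul_sum, Finset.prod_univ_sum, Fintype.piFinset_univ]
        simp only [pow_hamming, Finset.prod_mul_distrib]
    _ ≤ Real.exp (-(τ * (k + 1))) * Real.exp (P * (Real.exp τ * y)) := by
        gcongr
        refine prod_sum_le_exp _ _ (fun i h => mul_nonneg (by split_ifs <;> positivity) (h0 i h))
          (fun i => by simpa using hf0 i) (fun i => ?_)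
        simpa using mul_le_mul_of_nonneg_left (hf1 i) (Real.exp_pos τ).le
    _ = _ := by rw [← Real.exp_add]; congr 1; ring

end Tail

/-! ### Coefficients of the fractional power -/

section FractionalPower

/-- The eigenvalue of the fractional power of a reflection on the `-1` eigenspace, for the query
(`false`) and for the inverse query (`true`). -/
def phase (α : ℝ) : Bool → ℂ
  | false => Complex.exp (-(Complex.I * (Real.pi : ℂ) * (α : ℂ)))
  | true => star (Complex.exp (-(Complex.I * (Real.pi : ℂ) * (α : ℂ))))

/-- The coefficients of `1` and of the reflection in its fractional power. -/
def coef (α : ℝ) (a : Bool) : Fin 2 → ℂ := ![(1 + phase α a) / 2, (1 - phase α a) / 2]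

theorem exp_phase_eq (α : ℝ) :
    Complex.exp (-(Complex.I * (Real.pi : ℂ) * (α : ℂ)))
      = Complex.exp (Complex.I * ((-(Real.pi * α) : ℝ) : ℂ)) := by
  congr 1
  push_cast
  ring

theorem norm_phase (α : ℝ) (a : Bool) : ‖phase α a‖ = 1 := by
  have : ‖Complex.exp (-(Complex.I * (Real.pi : ℂ) * (α : ℂ)))‖ = 1 := by
    rw [exp_phase_eq, mul_comm, Complex.norm_exp_ofReal_mul_I]
  cases a
  · exact this
  · rw [phase, norm_star, this]

theorem norm_coef_zero_le (α : ℝ) (a : Bool) : ‖coef α a 0‖ ≤ 1 := by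
  have := norm_add_le 1 (phase α a)
  rw [norm_phase, norm_one] at this
  simp only [coef, Matrix.cons_val_zero, norm_div, Complex.norm_ofNat]
  linarith

/-- On the unit circle the chord from 1 to the phase is no longer than the arc `πα`. -/
theorem norm_coef_one_le {α : ℝ} (hα : 0 ≤ α) (a : Bool) :
    ‖coef α a 1‖ ≤ Real.pi * α / 2 := by
  have h : ‖1 - Complex.exp (-(Complex.I * (Real.pi : ℂ) * (α : ℂ)))‖ ≤ Real.pi * α := by
    rw [exp_phase_eq, norm_sub_rev]
    refine Real.norm_exp_I_mul_ofReal_sub_one_le.trans ?_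
    rw [norm_neg, Real.norm_of_nonneg (by positivity)]
  have : ‖1 - phase α a‖ ≤ Real.pi * α := by
    cases a
    · exact h
    · rwa [phase, ← star_one ℂ, ← star_sub, norm_star]
  simp only [coef, Matrix.cons_val_one, Matrix.cons_val_fin_one, norm_div, Complex.norm_ofNat]
  linarith

/-- The two coefficients sum to 1. -/
theorem sum_norm_coef_pos (α : ℝ) (a : Bool) : 0 < ∑ h, ‖coef α a h‖ := by
  have h : coef α a 0 + coef α a 1 = 1 := by simp [coef]; ring
  have := norm_add_le (coef α a 0) (coef α a 1)
  rw [h, norm_one] at this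
  rw [Fin.sum_univ_two]
  linarith

variable {d : ℕ} {W : Type*} [DecidableEq W]

theorem fracOracle_eq {R : Matrix (Fin d) (Fin d) ℂ} (hR : Rᴴ = R) (α : ℝ) (a : Bool) :
    fracOracle (fracPow R α) a = coef α a 0 • (1 : Matrix (Fin d × W) (Fin d × W) ℂ)
      + coef α a 1 • (R ⊗ₖ (1 : Matrix W W ℂ)) := by
  have key : ∀ e : ℂ, ((1 / 2 : ℂ) • (1 + R) + (e * (1 / 2 : ℂ)) • (1 - R)) ⊗ₖ (1 : Matrix W W ℂ)
      = ((1 + e) / 2) • (1 : Matrix (Fin d × W) (Fin d × W) ℂ)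
        + ((1 - e) / 2) • (R ⊗ₖ (1 : Matrix W W ℂ)) := fun e => by
    rw [show (1 / 2 : ℂ) • (1 + R) + (e * (1 / 2 : ℂ)) • (1 - R)
      = ((1 + e) / 2) • (1 : Matrix (Fin d) (Fin d) ℂ) + ((1 - e) / 2) • R by module,
      Matrix.add_kronecker, Matrix.smul_kronecker, Matrix.smul_kronecker, Matrix.one_kronecker_one]
  cases a
  · exact key _
  · have h : (fracPow R α)ᴴ = (1 / 2 : ℂ) • (1 + R) + (phase α true * (1 / 2 : ℂ)) • (1 - R) := by
      simp [fracPow, phase, Matrix.conjTranspose_add, Matrix.conjTranspose_sub,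
        Matrix.conjTranspose_smul, hR]
    rw [fracOracle, h, key]
    rfl

end FractionalPower

/-! ### Numerical accuracy and truncation error -/

/-- The error bound of the compression is below the required accuracy. -/
theorem four_mul_exp_tail_lt {α : ℝ} (hα : 0 < α) (P k : ℕ)
    (hk : 49 + 100 * α * ((P + 1 : ℕ) : ℝ) ≤ k + 1) :
    4 * Real.exp (P * (Real.exp 4 * (Real.pi * α / 2)) - 4 * (k + 1))
      < Real.exp (-(99 * α * Real.pi * ((P + 1 : ℕ) : ℝ)) - 20) := by
  have he : Real.exp 4 < 54.6 := by
    have h1 := Real.exp_one_lt_d9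
    have h2 : Real.exp 4 = Real.exp 1 ^ 4 := by rw [← Real.exp_nat_mul]; norm_num
    rw [h2]
    calc Real.exp 1 ^ 4 < 2.7182818286 ^ 4 := by gcongr
      _ < 54.6 := by norm_num
  have h4 : (4 : ℝ) ≤ Real.exp 3 := by
    have := Real.add_one_le_exp (3 : ℝ)
    linarith
  have hpi := Real.pi_lt_d4
  have hpi0 := Real.pi_pos
  set x : ℝ := α * ((P + 1 : ℕ) : ℝ) with hx
  have hx0 : 0 ≤ x := by positivity
  have hPx : α * P ≤ x := by rw [hx]; push_cast; nlinarith
  have hmain : P * (Real.exp 4 * (Real.pi * α / 2)) ≤ 27.3 * Real.pi * x := by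
    calc P * (Real.exp 4 * (Real.pi * α / 2)) = (Real.exp 4 / 2 * Real.pi) * (α * P) := by ring
      _ ≤ (27.3 * Real.pi) * x := by
        gcongr
        linarith
  have hpix : Real.pi * x ≤ 3.1416 * x := by gcongr
  calc 4 * Real.exp (P * (Real.exp 4 * (Real.pi * α / 2)) - 4 * (k + 1))
      ≤ Real.exp 3 * Real.exp (P * (Real.exp 4 * (Real.pi * α / 2)) - 4 * (k + 1)) := by gcongr
    _ = Real.exp (3 + (P * (Real.exp 4 * (Real.pi * α / 2)) - 4 * (k + 1))) := by
        rw [Real.exp_add]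
    _ < _ := by
        apply Real.exp_lt_exp.mpr
        have e1 : 100 * α * ((P + 1 : ℕ) : ℝ) = 100 * x := by rw [hx]; ring
        have e2 : 99 * α * Real.pi * ((P + 1 : ℕ) : ℝ) = 99 * (Real.pi * x) := by rw [hx]; ring
        rw [e1] at hk
        rw [e2]
        -- The coefficients of `x` satisfy `(27.3 + 99)π < 397 < 400 = 4 · 100`, and the constants
        -- satisfy `3 - 4 · 49 < -20`.
        nlinarith

/-- Words beyond the threshold contribute at most twice their total weight. -/
theorem norm_act_sum_sub_le {n : Type*} [Fintype n] [DecidableEq n] {P : ℕ}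
    (w : (Fin P → Fin 2) → ℂ) (T T' : (Fin P → Fin 2) → Matrix n n ℂ)
    (hT : ∀ b, T b ∈ Matrix.unitaryGroup n ℂ) (hT' : ∀ b, T' b ∈ Matrix.unitaryGroup n ℂ) (k : ℕ)
    (h : ∀ b, hamming P b ≤ k → T b = T' b) (v : EuclideanSpace ℂ n) (hv : ‖v‖ = 1) :
    ‖act (∑ b, w b • T b) v - act (∑ b, w b • T' b) v‖
      ≤ 2 * ∑ b with k < hamming P b, ‖w b‖ := by
  rw [← act_sub, ← Finset.sum_sub_distrib, act_sum, Finset.mul_sum,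
    ← Finset.sum_filter_add_sum_filter_not Finset.univ (fun b => k < hamming P b)]
  rw [Finset.sum_eq_zero (s := Finset.univ.filter fun b => ¬ k < hamming P b), add_zero]
  · refine norm_sum_le_of_le _ fun b _ => ?_
    rw [← smul_sub, act_smul, act_sub, norm_smul, mul_comm]
    gcongr
    refine (norm_sub_le _ _).trans ?_
    rw [norm_act_of_mem_unitaryGroup (hT b), norm_act_of_mem_unitaryGroup (hT' b), hv]
    norm_num
  · intro b hb
    rw [h b (by simpa using hb), sub_self]
    simp [act]

end QueryCircuit

/-! ### Assembly -/

theorem lemma4p4 {d : ℕ} {W : Type*} [Fintype W] [DecidableEq W] (Q : ℕ) (α : ℝ)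
    (hα0 : 0 < α) (hα1 : α ≤ 1)
    (C : QueryCircuit.Circuit (Fin d × W) Bool)
    (hC : QueryCircuit.Circuit.queryCount C = Q) :
    ∃ C' : QueryCircuit.Circuit ((Fin Q → Fin 2) × (Fin d × W)) (Fin Q),
      (QueryCircuit.Circuit.queryCount C' : ℝ) ≤ 50 + 100 * α * (Q : ℝ) ∧
      ∀ R : Matrix (Fin d) (Fin d) ℂ, R ∈ Matrix.unitaryGroup (Fin d) ℂ → R * R = 1 →
        ∀ ψ : EuclideanSpace ℂ (Fin d × W), ‖ψ‖ = 1 →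
          ∃ (ν : ℂ) (out : EuclideanSpace ℂ (Fin d × W))
            (Φ : EuclideanSpace ℂ ((Fin Q → Fin 2) × (Fin d × W))),
            QueryCircuit.act
                (QueryCircuit.Circuit.eval (QueryCircuit.ctrlOracle Q R) C')
                (QueryCircuit.zeroKet Q ψ) = ν • QueryCircuit.zeroKet Q out + Φ ∧
            ‖out‖ = 1 ∧
            QueryCircuit.zeroBra Q Φ = 0 ∧
            0.99 * Real.exp (-(α * Real.pi * ((Q : ℝ) / 2))) ≤ ‖ν‖ ∧
            ‖out - QueryCircuit.act
                (QueryCircuit.Circuit.eval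
                  (QueryCircuit.fracOracle (QueryCircuit.fracPow R α)) C) ψ‖
              < Real.exp (-(99 * α * Real.pi * (Q : ℝ)) - 20) := by
  open QueryCircuit in
  obtain ⟨U, L, hL⟩ := C.exists_altEval
  subst hC
  generalize C.queryCount = Q at L hL
  have hRstar : ∀ R : Matrix (Fin d) (Fin d) ℂ, R ∈ Matrix.unitaryGroup (Fin d) ℂ → R * R = 1 →
      Rᴴ = R := fun R hR hRR => by
    have h := Matrix.mem_unitaryGroup_iff.mp hR
    rw [Matrix.star_eq_conjTranspose] at h
    calc Rᴴ = R * R * Rᴴ := by rw [hRR, one_mul]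
      _ = R := by rw [Matrix.mul_assoc, h, mul_one]
  cases Q with
  | zero =>
    -- Without ancillas there is no qubit 0 to reuse, but the circuit is then a fixed unitary and
    -- postselection is exact, with `N = 1` and `δ = 0`.
    refine ⟨[ctrlGate fun _ => U], by simp [ctrlGate, Circuit.queryCount], fun R _ _ ψ hψ => ?_⟩
    have hU : act (C.eval (fracOracle (fracPow R α))) ψ = act (U : Matrix _ _ ℂ) ψ := by
      rw [hL]; simp [altEval]
    obtain ⟨ν, out, Φ, h1, h2, h3, h4, h5⟩ := exists_postselected
      (act (Circuit.eval (ctrlOracle 0 R) [ctrlGate fun _ => U]) (zeroKet 0 ψ))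
      (act (U : Matrix _ _ ℂ) ψ) 0 1 0 one_pos (by rw [norm_act_of_mem_unitaryGroup U.2, hψ])
      (by simp) (by norm_num) (by
        rw [zeroBra_act_zeroKet]
        simp [Circuit.eval, Gate.eval, ctrlGate, blk_ctrl])
    refine ⟨ν, out, Φ, h1, h2, h3, by simpa using h4, ?_⟩
    rw [hU]
    exact h5.trans_lt (by rw [mul_zero]; positivity)
  | succ P =>
    have hx : 0 ≤ 49 + 100 * α * ((P + 1 : ℕ) : ℝ) := by positivity
    -- The constant is 49 rather than 50 because the separately treated first query costs one more.
    set k := ⌊49 + 100 * α * ((P + 1 : ℕ) : ℝ)⌋₊ with hk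
    have hk1 : (k : ℝ) ≤ 49 + 100 * α * ((P + 1 : ℕ) : ℝ) := Nat.floor_le hx
    have hk2 : 49 + 100 * α * ((P + 1 : ℕ) : ℝ) ≤ k + 1 := (Nat.lt_floor_add_one _).le
    obtain ⟨C', hcount, hC'⟩ :=
      exists_compressed_circuit U L (coef α) (sum_norm_coef_pos α) k
    refine ⟨C', by rw [hcount]; push_cast at hk1 ⊢; linarith, fun R hR hRR ψ hψ => ?_⟩
    obtain ⟨T, hT, hTw, hblk⟩ := hC' R hR
    set S := R ⊗ₖ (1 : Matrix W W ℂ) with hS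
    have hSu : S ∈ Matrix.unitaryGroup (Fin d × W) ℂ :=
      Matrix.kronecker_mem_unitary hR (one_mem _)
    have ho : ∀ a, fracOracle (fracPow R α) a
        = coef α a 0 • (1 : Matrix (Fin d × W) (Fin d × W) ℂ) + coef α a 1 • S :=
      fracOracle_eq (hRstar R hR hRR) α
    have hou : ∀ a, fracOracle (W := W) (fracPow R α) a ∈ Matrix.unitaryGroup (Fin d × W) ℂ :=
      fun a => by
        rw [ho]
        refine smul_one_add_smul_mem_unitaryGroup ?_ ?_ (norm_phase α a)
        · rw [hS, Matrix.conjTranspose_kronecker, hRstar R hR hRR, Matrix.conjTranspose_one]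
        · rw [hS, ← Matrix.mul_kronecker_mul, hRR, one_mul, Matrix.one_kronecker_one]
    set φ := act ((L 0).2.1 * fracOracle (fracPow R α) (L 0).1 * U.1) ψ with hφ
    have hφ1 : ‖φ‖ = 1 := by
      rw [hφ, norm_act_of_mem_unitaryGroup (mul_mem (mul_mem (L 0).2.2 (hou _)) U.2), hψ]
    set w : (Fin P → Fin 2) → ℂ := fun b => ∏ i, coef α (Fin.tail L i).1 (b i) with hw
    have htarget : act (C.eval (fracOracle (fracPow R α))) ψ
        = act (∑ b, w b • wordEval S P (Fin.tail L) b) φ := by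
      rw [hL, hφ, ← act_mul, altEval, altEval_eq_sum _ S (coef α) ho, Matrix.mul_assoc]
    set N : ℝ := ∏ i, ∑ h, ‖coef α (L i).1 h‖ with hN
    have hN0 : 0 < N := Finset.prod_pos fun i _ => sum_norm_coef_pos α _
    set tail : ℝ := ∑ b with k < hamming P b, ‖w b‖ with htail
    have htail_le : tail
        ≤ Real.exp (P * (Real.exp 4 * (Real.pi * α / 2)) - 4 * (k + 1)) := by
      have := sum_tail_le (fun i h => ‖coef α (Fin.tail L i).1 h‖) (Real.pi * α / 2)
        (fun _ _ => norm_nonneg _) (fun _ => norm_coef_zero_le α _)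
        (fun _ => norm_coef_one_le hα0.le _) k 4 (by norm_num)
      simpa only [htail, hw, norm_prod] using this
    -- The factor 4 is 2 for replacing one unitary by another on each tail word, times 2 from
    -- postselection.
    have hacc := four_mul_exp_tail_lt hα0 P k hk2
    -- With `4 * tail` below this exponential, `δ = 2 * tail` meets the threshold `1 / 100` that
    -- yields the factor 0.99.
    have hsmall : Real.exp (-(99 * α * Real.pi * ((P + 1 : ℕ) : ℝ)) - 20) ≤ 1 / 50 := by
      have h1 : Real.exp (-(99 * α * Real.pi * ((P + 1 : ℕ) : ℝ)) - 20) ≤ Real.exp (-4) := by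
        apply Real.exp_le_exp.mpr
        have : 0 ≤ 99 * α * Real.pi * ((P + 1 : ℕ) : ℝ) := by positivity
        linarith
      have h2 : (50 : ℝ) ≤ Real.exp 4 := by
        have h1 := Real.exp_one_gt_d9
        have h2 : Real.exp 4 = Real.exp 1 ^ 4 := by rw [← Real.exp_nat_mul]; norm_num
        rw [h2]
        calc (50 : ℝ) ≤ 2.7182818283 ^ 4 := by norm_num
          _ ≤ Real.exp 1 ^ 4 := by gcongr
      rw [Real.exp_neg] at h1
      exact h1.trans (by rw [one_div]; gcongr)
    obtain ⟨ν, out, Φ, h1, h2, h3, h4, h5⟩ := exists_postselected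
      (act (C'.eval (ctrlOracle (P + 1) R)) (zeroKet (P + 1) ψ))
      (act (C.eval (fracOracle (fracPow R α))) ψ)
      (act (∑ b, w b • T b) φ - act (∑ b, w b • wordEval S P (Fin.tail L) b) φ) N (2 * tail) hN0
      (by
        rw [hL, norm_act_of_mem_unitaryGroup
          (mul_mem (altEval_mem_unitaryGroup hou _ _) U.2), hψ])
      (norm_act_sum_sub_le w T _ hT (fun b => wordEval_mem_unitaryGroup hSu P _ b) k hTw φ hφ1)
      (by linarith)
      (by
        rw [zeroBra_act_zeroKet, hblk, act_smul, htarget, add_sub_cancel, hφ, ← act_mul, ho,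
          Matrix.mul_assoc])
    refine ⟨ν, out, Φ, h1, h2, h3, le_trans ?_ h4, h5.trans_lt (by linarith)⟩
    have hNle : N ≤ Real.exp (((P + 1 : ℕ) : ℝ) * (Real.pi * α / 2)) :=
      prod_sum_le_exp (fun i h => ‖coef α (L i).1 h‖) _ (fun _ _ => norm_nonneg _)
        (fun _ => norm_coef_zero_le α _) (fun _ => norm_coef_one_le hα0.le _)
    rw [show α * Real.pi * (((P + 1 : ℕ) : ℝ) / 2) = ((P + 1 : ℕ) : ℝ) * (Real.pi * α / 2) by ring,
      Real.exp_neg]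
    gcongr

end
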